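/- All graphs are finite, simple and undirected. A graph $H$ is a \emph{minor} of a graph $G$ if one can assign to the vertices of $H$ pairwise vertex-disjoint (nonempty) connected subgraphs of $G$ such that the subgraphs assigned to any two adjacent vertices of $H$ are joined by an edge of $G$. Let $G^{(q)}$ denote the graph obtained from $G$ by replacing each vertex with a $q$-clique: its vertices are $u_i$ for $u\in V(G)$, $1\le i\le q$, and $u_iv_j$ is an edge whenever $u_i\ne v_j$ and either $u=v$ or $uv\in E(G)$. Let $\mathrm{emb}(G)$ be the supremum of all real $r>0$ for which there is an $m_0=m_0(G,r)$ such that every graph $H$ with $m\ge m_0$ edges and no isolated vertices is a minor of $G^{(\lceil m/r\rceil)}$ (with $\sup\emptyset=0$). (It is not required that a minor mapping be efficiently computable; adding such a requirement can only decrease $\mathrm{emb}(G)$, so the bounds below hold a fortiori with it.) A \emph{threshold weighting} on $G$ is a pair $\Delta=(\alpha,\beta)\in[0,1]^{V(G)}\times[0,2]^{E(G)}$ such that, writing $\Delta(H)=\sum_{u\in V(H)}\alpha(u)-\sum_{e\in E(H)}\beta(e)$, one has $\Delta(H)\ge 0$ for all subgraphs $H\subseteq G$ and $\Delta(G)=0$.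 A \emph{union sequence} of $G$ is a sequence $(H_1,\dots,H_k)$, $k\ge1$, of distinct subgraphs of $G$ with $H_k=G$ in which each $H_i$ is either a single edge (with its two endpoints) or the union of two earlier members. For $G$ without isolated vertices let $\kappa(G)=\max_\Delta\min_S\max_{H\in S}\Delta(H)$, over threshold weightings $\Delta$ and union sequences $S$. \textbf{Theorem.} $\mathrm{emb}(G)=O(\kappa(G))$. More precisely, there is an absolute constant $C$ such that for every graph $G$ without isolated vertices, \[ \mathrm{emb}(G)\le C\max(\kappa(G),1), \] and $\mathrm{emb}(G)\le C\,\kappa(G)$ whenever some vertex of $G$ has at least two neighbours (that is, whenever $G$ is not just a disjoint union of single edges). -/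

import Mathlib

open scoped NNReal ENNReal

/-- `G` has no isolated vertices. -/
def NoIsolated {V : Type*} (G : SimpleGraph V) : Prop :=
  ∀ v, ¬ G.IsIsolated v

/-- `H` is a minor of `G`: there is a minor mapping, i.e. an assignment of pairwise vertex-disjoint
connected (in particular nonempty) subgraphs of `G` to the vertices of `H`, such that the images
of adjacent vertices of `H` are joined by an edge of `G`. -/
def IsGraphMinor {W V : Type*} (H : SimpleGraph W) (G : SimpleGraph V) : Prop :=
  ∃ φ : W → G.Subgraph,
    (∀ w, (φ w).Connected) ∧
    (∀ u v, u ≠ v → Disjoint (φ u).verts (φ v).verts) ∧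
    (∀ u v, H.Adj u v → ∃ x ∈ (φ u).verts, ∃ y ∈ (φ v).verts, G.Adj x y)

/-- The graph obtained from `G` by replacing each vertex with a `q`-clique. -/
def cliqueBlowup {V : Type*} (G : SimpleGraph V) (q : ℕ) : SimpleGraph (V × Fin q) where
  Adj x y := x ≠ y ∧ (x.1 = y.1 ∨ G.Adj x.1 y.1)
  symm := ⟨fun _ _ h => ⟨h.1.symm, h.2.imp Eq.symm fun a => a.symm⟩⟩
  loopless := ⟨fun _ h => h.1 rfl⟩

/-- There is an `m₀` such that every finite graph `H` with `m ≥ m₀` edges and no isolated vertices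
is a minor of the blowup of `G` by cliques of size `⌈m / r⌉`. Up to isomorphism, the finite graphs
are the graphs on `Fin n`. -/
def EmbAdmissible {V : Type*} (G : SimpleGraph V) (r : ℝ) : Prop :=
  ∃ m₀ : ℕ, ∀ (n : ℕ) (H : SimpleGraph (Fin n)), NoIsolated H → m₀ ≤ H.edgeSet.ncard →
    IsGraphMinor H (cliqueBlowup G ⌈(H.edgeSet.ncard : ℝ) / r⌉₊)

/-- The embedding parameter: the supremum of all admissible `r > 0`. -/
noncomputable def emb {V : Type*} (G : SimpleGraph V) : ℝ≥0∞ :=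
  ⨆ (r : ℝ) (_ : 0 < r ∧ EmbAdmissible G r), ENNReal.ofReal r

open Classical in
/-- `Δ(H) = α(H) - β(H)`, the total vertex weight minus the total edge weight of `H`. -/
noncomputable def weightDiff {V : Type*} [Fintype V] {G : SimpleGraph V}
    (α : V → ℝ) (β : Sym2 V → ℝ) (H : G.Subgraph) : ℝ :=
  (∑ v with v ∈ H.verts, α v) - ∑ e with e ∈ H.edgeSet, β e

/-- Threshold weightings on `G`. The edge weighting is extended by `0` to the non-edges. -/
structure ThresholdWeighting {V : Type*} [Fintype V] (G : SimpleGraph V) where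
  α : V → ℝ
  β : Sym2 V → ℝ
  α_mem : ∀ v, α v ∈ Set.Icc (0 : ℝ) 1
  β_mem : ∀ e ∈ G.edgeSet, β e ∈ Set.Icc (0 : ℝ) 2
  β_eq_zero : ∀ e ∉ G.edgeSet, β e = 0
  nonneg : ∀ H : G.Subgraph, 0 ≤ weightDiff α β H
  eq_zero : weightDiff α β (⊤ : G.Subgraph) = 0

/-- Union sequences: nonempty sequences of distinct subgraphs of `G`, ending in `G`, each of which
is an edge or the union of two previous ones. -/
structure UnionSequence {V : Type*} (G : SimpleGraph V) where
  lastIdx : ℕ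
  graph : Fin (lastIdx + 1) → G.Subgraph
  injective : Function.Injective graph
  graph_last : graph (Fin.last lastIdx) = ⊤
  edge_or_union : ∀ i,
    (∃ (u v : V) (h : G.Adj u v), graph i = G.subgraphOfAdj h) ∨
    (∃ j k, j < i ∧ k < i ∧ graph i = graph j ⊔ graph k)

/-- `κ_Δ(G)`, the minimum over union sequences `S` of the maximum of `Δ(H)` over `H` in `S`
(recall that `Δ(H) ≥ 0`). -/
noncomputable def kappaOf {V : Type*} [Fintype V] {G : SimpleGraph V}
    (D : ThresholdWeighting G) : ℝ≥0∞ :=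
  ⨅ S : UnionSequence G, ⨆ i, ENNReal.ofReal (weightDiff D.α D.β (S.graph i))

/-- `κ(G)`, the maximum of `κ_Δ(G)` over all threshold weightings `Δ` on `G`. -/
noncomputable def kappa {V : Type*} [Fintype V] (G : SimpleGraph V) : ℝ≥0∞ :=
  ⨆ D : ThresholdWeighting G, kappaOf D

/-! A bounded-degree-like expander is hard to embed, and any embedding of it into a blowup of `G`
yields a threshold weighting witnessing large `kappa`. Take functions `f j` on `n` points, `j` in a
set `J` of 49 indices, such that any two sets of at least `n / 6` points are joined by some pair
`(x, f j x)`; let `H` be the graph of these pairs, with `m = Θ(n)` edges. If `r` is admissible, `H`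
is a minor of the `q`-blowup with `q` about `m / r`. Project the branch set of each `w` to `G`,
choose a rooted spanning tree of the projection, and for each `j` choose an edge of `G` touching the
projections of both `w` and `f j w`. Each `w` gives weight 1 to its projected vertices and to its
tree edges, and weight `1 / |J|` to each of its chosen edges; everything is divided by `q`. A tree
has one more vertex than edges and the chosen edges weigh 1 in total, so every `w` balances on `G`.
On a subgraph `F` its contribution is nonnegative, and at least `1 / |J|` if its projection meets
`F` while some chosen edge lies outside `F`. Every union sequence has a member `F` containing
between one and two thirds of the chosen edges. Expansion then forces at least `n / 6` such mixed
`w`, so `Δ(F) ≥ n / (6 |J| q)`, which is of order `r`. -/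

/-- The projection of a connected graph to `G`, rooted at a vertex: every other vertex of the
projection has a parent of smaller rank. -/
theorem SimpleGraph.Connected.exists_parent {X V : Type*} {K : SimpleGraph X} (hK : K.Connected)
    (G : SimpleGraph V) (π : X → V)
    (hπ : ∀ x y, K.Adj x y → π x = π y ∨ G.Adj (π x) (π y)) :
    ∃ (ρ : V) (par : V → V) (rank : V → ℕ), ρ ∈ Set.range π ∧
      ∀ v ∈ Set.range π, v ≠ ρ →
        par v ∈ Set.range π ∧ G.Adj v (par v) ∧ rank (par v) < rank v := by
  obtain ⟨x₀⟩ := hK.nonempty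
  let rank : V → ℕ := fun v => sInf {k | ∃ x, π x = v ∧ K.dist x x₀ = k}
  have key : ∀ v ∈ Set.range π, v ≠ π x₀ →
      ∃ u ∈ Set.range π, G.Adj v u ∧ rank u < rank v := by
    rintro v ⟨x', hx'⟩ hv
    obtain ⟨x, hx, hxr⟩ : rank v ∈ {k | ∃ x, π x = v ∧ K.dist x x₀ = k} :=
      Nat.sInf_mem ⟨_, x', hx', rfl⟩
    -- The first step of a geodesic from the lift of `v` nearest to `x₀` leaves the fibre of `v`,
    -- because it lowers the rank.
    obtain ⟨p, hp⟩ := hK.exists_walk_length_eq_dist x x₀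
    cases p with
    | nil => exact absurd hx.symm hv
    | @cons _ y _ h p =>
      have h1 : rank (π y) ≤ K.dist y x₀ := Nat.sInf_le ⟨y, rfl, rfl⟩
      have h2 : K.dist y x₀ ≤ p.length := K.dist_le p
      rw [SimpleGraph.Walk.length_cons] at hp
      have h3 : rank (π y) < rank v := by omega
      refine ⟨π y, ⟨y, rfl⟩, ?_, h3⟩
      subst hx
      rcases hπ x y h with h | h
      · rw [h] at h3
        exact absurd h3 (lt_irrefl _)
      · exact h
  choose! par hpar using key
  exact ⟨π x₀, par, rank, ⟨x₀, rfl⟩, hpar⟩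

/-! ### Expanding functions, by counting -/

/-- Functions `f j` on `Fin n` such that any two large sets are joined by some pair `(x, f j x)`. -/
theorem exists_expanding_functions (n : ℕ) (hn : 0 < n) :
    ∃ f : Fin 48 → Fin n → Fin n, ∀ A B : Finset (Fin n), n ≤ 6 * A.card → n ≤ 6 * B.card →
      ∃ j, ∃ x ∈ A, f j x ∈ B := by
  classical
  by_contra! hcon
  -- Union bound: `S A B` lists the values allowed to a function tuple that never maps `A` into `B`.
  let S : Finset (Fin n) → Finset (Fin n) → Fin 48 × Fin n → Finset (Fin n) :=
    fun A B p => if p.2 ∈ A then Bᶜ else Finset.univ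
  let I : Finset (Finset (Fin n) × Finset (Fin n)) :=
    Finset.univ.filter fun p => n ≤ 6 * p.1.card ∧ n ≤ 6 * p.2.card
  have hn' : (0 : ℝ) < n := by exact_mod_cast hn
  have hcover : (Finset.univ : Finset (Fin 48 × Fin n → Fin n)) ⊆
      I.biUnion fun p => Fintype.piFinset (S p.1 p.2) := by
    intro g _
    obtain ⟨A, B, hA, hB, h⟩ := hcon fun j x => g (j, x)
    refine Finset.mem_biUnion.2 ⟨(A, B), by simp [I, hA, hB], Fintype.mem_piFinset.2 ?_⟩
    rintro ⟨j, x⟩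
    by_cases hx : x ∈ A
    · simpa [S, hx] using h j x hx
    · simp [S, hx]
  have hbad : ∀ p ∈ I, ((Fintype.piFinset (S p.1 p.2)).card : ℝ) ≤
      (n : ℝ) ^ (48 * n) * ((5 / 6 : ℝ) ^ 8) ^ n := by
    rintro ⟨A, B⟩ hp
    obtain ⟨hA, hB⟩ : n ≤ 6 * A.card ∧ n ≤ 6 * B.card := by simpa [I] using hp
    have hBc : ((Bᶜ).card : ℝ) ≤ n * (5 / 6) := by
      have : (Bᶜ).card + B.card = n := by simp
      have h1 : ((Bᶜ).card : ℝ) + B.card = n := by exact_mod_cast this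
      have h2 : (n : ℝ) ≤ 6 * B.card := by exact_mod_cast hB
      linarith
    calc ((Fintype.piFinset (S A B)).card : ℝ)
        = ∏ p : Fin 48 × Fin n, ((S A B p).card : ℝ) := by
          rw [Fintype.card_piFinset]; push_cast; rfl
      _ ≤ ∏ p : Fin 48 × Fin n, ((n : ℝ) * if p.2 ∈ A then 5 / 6 else 1) := by
          refine Finset.prod_le_prod (fun _ _ => by positivity) fun p _ => ?_
          by_cases hx : p.2 ∈ A
          · simpa [S, hx] using hBc
          · simp [S, hx]
      _ = (n : ℝ) ^ (48 * n) * ((5 / 6 : ℝ) ^ A.card) ^ 48 := by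
          rw [Finset.prod_mul_distrib, Fintype.prod_prod_type, Fintype.prod_prod_type]
          congr 1
          · simp [← pow_mul, mul_comm]
          · simp only [Finset.prod_ite, Finset.filter_univ_mem, Finset.prod_const,
              one_pow, mul_one, Finset.card_univ, Fintype.card_fin]
      _ ≤ (n : ℝ) ^ (48 * n) * ((5 / 6 : ℝ) ^ 8) ^ n := by
          rw [← pow_mul, ← pow_mul]
          refine mul_le_mul_of_nonneg_left ?_ (by positivity)
          exact pow_le_pow_of_le_one (by norm_num) (by norm_num) (by omega)
  have hI : (I.card : ℝ) ≤ 4 ^ n := by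
    have : I.card ≤ 4 ^ n := by
      refine (Finset.card_le_univ I).trans ?_
      simp [Fintype.card_prod, ← mul_pow]
    exact_mod_cast this
  have hcard : (n : ℝ) ^ (48 * n) ≤ 4 ^ n * ((n : ℝ) ^ (48 * n) * ((5 / 6 : ℝ) ^ 8) ^ n) := by
    calc (n : ℝ) ^ (48 * n) = ((Finset.univ : Finset (Fin 48 × Fin n → Fin n)).card : ℝ) := by
          simp
      _ ≤ ((I.biUnion fun p => Fintype.piFinset (S p.1 p.2)).card : ℝ) := by
          exact_mod_cast Finset.card_le_card hcover
      _ ≤ ∑ p ∈ I, ((Fintype.piFinset (S p.1 p.2)).card : ℝ) := by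
          exact_mod_cast Finset.card_biUnion_le
      _ ≤ I.card * ((n : ℝ) ^ (48 * n) * ((5 / 6 : ℝ) ^ 8) ^ n) := by
          simpa using Finset.sum_le_card_nsmul _ _ _ hbad
      _ ≤ _ := by gcongr
  -- There are at most `4 ^ n` pairs `(A, B)`, and `48 * A.card ≥ 8 * n` constrained values per
  -- pair; 48 is large enough to make this base less than 1.
  have hlt : (4 * (5 / 6 : ℝ) ^ 8) ^ n < 1 := pow_lt_one₀ (by norm_num) (by norm_num) hn.ne'
  have hpos : (0 : ℝ) < (n : ℝ) ^ (48 * n) := by positivity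
  rw [mul_pow] at hlt
  nlinarith

/-! ### Balanced members of union sequences -/

/-- A subadditive count along a union sequence takes a balanced value. -/
theorem UnionSequence.exists_balanced {V X : Type*} [Fintype X] {G : SimpleGraph V}
    (S : UnionSequence G) (g : X → Sym2 V) (hg : ∀ x, g x ∈ G.edgeSet)
    (hX : 0 < Nat.card X)
    (hsmall : ∀ e ∈ G.edgeSet, 3 * Nat.card {x // g x = e} ≤ Nat.card X) :
    ∃ i, Nat.card X < 3 * Nat.card {x // g x ∈ (S.graph i).edgeSet} ∧
      3 * Nat.card {x // g x ∈ (S.graph i).edgeSet} ≤ 2 * Nat.card X := by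
  classical
  -- The first member exceeding one third is not a single edge, so it is a union of two earlier
  -- members holding at most a third each.
  let p : ℕ → Prop := fun k => ∃ h : k < S.lastIdx + 1,
    Nat.card X < 3 * Nat.card {x // g x ∈ (S.graph ⟨k, h⟩).edgeSet}
  have hp : ∃ k, p k := by
    refine ⟨S.lastIdx, Nat.lt_succ_self _, ?_⟩
    have : S.graph ⟨S.lastIdx, Nat.lt_succ_self _⟩ = ⊤ := S.graph_last
    rw [this]
    have : Nat.card {x // g x ∈ (⊤ : G.Subgraph).edgeSet} = Nat.card X :=
      Nat.card_congr (Equiv.subtypeUnivEquiv (by simp [hg]))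
    omega
  obtain ⟨hk, hlt⟩ := Nat.find_spec hp
  refine ⟨⟨Nat.find hp, hk⟩, hlt, ?_⟩
  have hmin : ∀ j : Fin (S.lastIdx + 1), j < ⟨Nat.find hp, hk⟩ →
      3 * Nat.card {x // g x ∈ (S.graph j).edgeSet} ≤ Nat.card X := by
    intro j hj
    by_contra! h
    exact Nat.find_min hp (Fin.lt_def.1 hj) ⟨j.2, h⟩
  rcases S.edge_or_union ⟨Nat.find hp, hk⟩ with ⟨u, v, h, he⟩ | ⟨j, k, hj, hk', he⟩
  · have := hsmall s(u, v) h
    simp only [he, SimpleGraph.edgeSet_subgraphOfAdj, Set.mem_singleton_iff] at hlt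
    omega
  · have h1 := hmin j hj
    have h2 := hmin k hk'
    have h3 : Nat.card {x // g x ∈ (S.graph ⟨Nat.find hp, hk⟩).edgeSet} ≤
        Nat.card {x // g x ∈ (S.graph j).edgeSet} +
          Nat.card {x // g x ∈ (S.graph k).edgeSet} := by
      rw [he]
      simp only [SimpleGraph.Subgraph.edgeSet_sup, Set.mem_union, Nat.card_eq_fintype_card]
      exact Fintype.card_subtype_or _ _
    omega

/-! ### Projected minors and the contribution of each branch set -/

/-- The projection to `G` of a minor mapping into a blowup of `G`: each `w : W` is assigned a set of
vertices of `G` with a parent function directed towards a root, and edges of `G` indexed by `J`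
that touch this set. -/
structure ProjectedMinor {V : Type*} (G : SimpleGraph V) (W J : Type*) (q : ℕ) where
  part : W → Set V
  root : W → V
  parent : W → V → V
  rank : W → V → ℕ
  edge : W → J → Sym2 V
  root_mem : ∀ w, root w ∈ part w
  parent_mem : ∀ w, ∀ v ∈ part w, v ≠ root w → parent w v ∈ part w
  parent_adj : ∀ w, ∀ v ∈ part w, v ≠ root w → G.Adj v (parent w v)
  rank_parent_lt : ∀ w, ∀ v ∈ part w, v ≠ root w → rank w (parent w v) < rank w v
  edge_mem : ∀ w j, edge w j ∈ G.edgeSet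
  edge_touch : ∀ w j, ∃ u ∈ edge w j, u ∈ part w
  load : ∀ v, Nat.card {w // v ∈ part w} ≤ q

namespace ProjectedMinor

variable {V W J : Type*} {G : SimpleGraph V} {q : ℕ}

open Classical in
/-- The non-root vertices of the part of `w`. -/
noncomputable def inner [Fintype V] (M : ProjectedMinor G W J q) (w : W) : Finset V :=
  {v | v ∈ M.part w ∧ v ≠ M.root w}

theorem mem_inner [Fintype V] (M : ProjectedMinor G W J q) {w : W} {v : V} :
    v ∈ M.inner w ↔ v ∈ M.part w ∧ v ≠ M.root w := by
  simp [inner]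

open Classical in
/-- The weight of an edge coming from `w`. -/
noncomputable def edgeWeight [Fintype V] [Fintype J] (M : ProjectedMinor G W J q) (w : W)
    (e : Sym2 V) : ℝ :=
  ((M.inner w).filter fun v => s(v, M.parent w v) = e).card +
    ((Finset.univ.filter fun j => M.edge w j = e).card : ℝ) / Fintype.card J

open Classical in
/-- The contribution of `w` to the weight of a subgraph. -/
noncomputable def contribution [Fintype V] [Fintype J] (M : ProjectedMinor G W J q) (w : W)
    (F : G.Subgraph) : ℝ :=
  ((Finset.univ.filter fun v => v ∈ F.verts ∧ v ∈ M.part w).card : ℝ) -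
    ((M.inner w).filter fun v => s(v, M.parent w v) ∈ F.edgeSet).card -
    ((Finset.univ.filter fun j => M.edge w j ∈ F.edgeSet).card : ℝ) / Fintype.card J

-- The tree edges inside `F` form a forest on the vertices of the part in `F`. Sending each edge to
-- its child end misses the vertex of least rank.
open Classical in
theorem card_parentEdge_add_one_le [Fintype V] (M : ProjectedMinor G W J q) (w : W)
    (F : G.Subgraph) {u : V} (hu : u ∈ F.verts) (huw : u ∈ M.part w) :
    ((M.inner w).filter fun v => s(v, M.parent w v) ∈ F.edgeSet).card + 1 ≤
      (Finset.univ.filter fun v => v ∈ F.verts ∧ v ∈ M.part w).card := by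
  obtain ⟨x, hx, hmin⟩ := Finset.exists_min_image
    (Finset.univ.filter fun v => v ∈ F.verts ∧ v ∈ M.part w) (M.rank w)
    ⟨u, by simp [hu, huw]⟩
  simp only [Finset.mem_filter, Finset.mem_univ, true_and] at hx hmin
  have hxn : x ∉ (M.inner w).filter fun v => s(v, M.parent w v) ∈ F.edgeSet := by
    intro h
    rw [Finset.mem_filter, mem_inner] at h
    have h1 := hmin _ ⟨F.edge_vert (SimpleGraph.Subgraph.mem_edgeSet.1 h.2).symm,
      M.parent_mem w x h.1.1 h.1.2⟩
    exact absurd (M.rank_parent_lt w x h.1.1 h.1.2) (not_lt.2 h1)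
  rw [← Finset.card_insert_of_notMem hxn]
  refine Finset.card_le_card fun v hv => ?_
  rcases Finset.mem_insert.1 hv with rfl | hv
  · simpa using hx
  · rw [Finset.mem_filter, mem_inner] at hv
    simp only [Finset.mem_filter, Finset.mem_univ, true_and]
    exact ⟨F.edge_vert hv.2, hv.1.1⟩

theorem contribution_nonneg [Fintype V] [Fintype J] (M : ProjectedMinor G W J q) (w : W)
    (F : G.Subgraph) : 0 ≤ M.contribution w F := by
  classical
  unfold contribution
  by_cases h : ∃ u ∈ F.verts, u ∈ M.part w
  · obtain ⟨u, hu, huw⟩ := h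
    have h1 := M.card_parentEdge_add_one_le w F hu huw
    have h2 : ((Finset.univ.filter fun j => M.edge w j ∈ F.edgeSet).card : ℝ) /
        Fintype.card J ≤ 1 :=
      div_le_one_of_le₀ (by exact_mod_cast Finset.card_le_univ _) (by positivity)
    have h3 : (((M.inner w).filter fun v => s(v, M.parent w v) ∈ F.edgeSet).card : ℝ) + 1 ≤
      (Finset.univ.filter fun v => v ∈ F.verts ∧ v ∈ M.part w).card := by exact_mod_cast h1
    linarith
  · push Not at h
    have h1 : ((M.inner w).filter fun v => s(v, M.parent w v) ∈ F.edgeSet) = ∅ := by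
      refine Finset.filter_eq_empty_iff.2 fun v hv he => ?_
      exact h v (F.edge_vert he) (M.mem_inner.1 hv).1
    have h2 : (Finset.univ.filter fun j => M.edge w j ∈ F.edgeSet) = ∅ := by
      refine Finset.filter_eq_empty_iff.2 fun j _ he => ?_
      obtain ⟨u, hu, huw⟩ := M.edge_touch w j
      exact h u (F.mem_verts_of_mem_edge he hu) huw
    rw [h1, h2]
    simp

/-- A part that meets `F`, but with an edge outside `F`, has a substantial contribution. -/
theorem le_contribution [Fintype V] [Fintype J] (M : ProjectedMinor G W J q) {w : W}
    {F : G.Subgraph} {u : V} (hu : u ∈ F.verts) (huw : u ∈ M.part w) {j : J}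
    (hj : M.edge w j ∉ F.edgeSet) : 1 / (Fintype.card J : ℝ) ≤ M.contribution w F := by
  classical
  unfold contribution
  have h1 := M.card_parentEdge_add_one_le w F hu huw
  have h3 : (((M.inner w).filter fun v => s(v, M.parent w v) ∈ F.edgeSet).card : ℝ) + 1 ≤
    (Finset.univ.filter fun v => v ∈ F.verts ∧ v ∈ M.part w).card := by exact_mod_cast h1
  have hJ : (0 : ℝ) < Fintype.card J := by exact_mod_cast Fintype.card_pos_iff.2 ⟨j⟩
  have h2 : (Finset.univ.filter fun j => M.edge w j ∈ F.edgeSet).card + 1 ≤ Fintype.card J :=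
    Finset.card_lt_univ_of_notMem (x := j) (by simpa using hj)
  have h2' : ((Finset.univ.filter fun j => M.edge w j ∈ F.edgeSet).card : ℝ) + 1 ≤
    Fintype.card J := by exact_mod_cast h2
  have h4 : ((Finset.univ.filter fun j => M.edge w j ∈ F.edgeSet).card : ℝ) /
      Fintype.card J + 1 / (Fintype.card J : ℝ) ≤ 1 := by
    rw [← add_div]
    exact div_le_one_of_le₀ h2' hJ.le
  linarith

/-- A spanning tree has exactly one more vertex than edges, and the chosen edges have total weight
1. -/
theorem contribution_top [Fintype V] [Fintype J] [Nonempty J] (M : ProjectedMinor G W J q)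
    (w : W) : M.contribution w ⊤ = 0 := by
  classical
  unfold contribution
  have h1 : (Finset.univ.filter fun v => v ∈ (⊤ : G.Subgraph).verts ∧ v ∈ M.part w) =
      insert (M.root w) (M.inner w) := by
    ext v
    simp only [SimpleGraph.Subgraph.verts_top, Set.mem_univ, true_and, Finset.mem_filter,
      Finset.mem_univ, Finset.mem_insert, mem_inner]
    by_cases hv : v = M.root w
    · simp [hv, M.root_mem]
    · simp [hv]
  have h2 : ((M.inner w).filter fun v => s(v, M.parent w v) ∈ (⊤ : G.Subgraph).edgeSet) =
      M.inner w := by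
    refine Finset.filter_true_of_mem fun v hv => ?_
    have := M.mem_inner.1 hv
    simpa using M.parent_adj w v this.1 this.2
  have h3 : (Finset.univ.filter fun j => M.edge w j ∈ (⊤ : G.Subgraph).edgeSet) =
      Finset.univ :=
    Finset.filter_true_of_mem fun j _ => by simpa using M.edge_mem w j
  have h4 : M.root w ∉ M.inner w := by simp [mem_inner]
  have hJ : (Fintype.card J : ℝ) ≠ 0 := by exact_mod_cast Fintype.card_ne_zero
  rw [h1, h2, h3, Finset.card_insert_of_notMem h4, Finset.card_univ, div_self hJ]
  push_cast
  ring

-- Summed over `w`, this bounds the weight of an edge by the loads of its two ends, which gives the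
-- bound 2 on `β`.
open Classical in
theorem edgeWeight_le [Fintype V] [Fintype J] (M : ProjectedMinor G W J q) (w : W) (u v : V) :
    M.edgeWeight w s(u, v) ≤
      (if u ∈ M.part w then 1 else 0) + (if v ∈ M.part w then 1 else 0) := by
  unfold edgeWeight
  have h2 : ((Finset.univ.filter fun j => M.edge w j = s(u, v)).card : ℝ) /
      Fintype.card J ≤ 1 :=
    div_le_one_of_le₀ (by exact_mod_cast Finset.card_le_univ _) (by positivity)
  have hpart : ∀ x ∈ M.inner w, s(x, M.parent w x) = s(u, v) → u ∈ M.part w ∧ v ∈ M.part w := by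
    intro x hx he
    have hx' := M.mem_inner.1 hx
    rcases Sym2.eq_iff.1 he with ⟨h1, h2⟩ | ⟨h1, h2⟩
    · exact ⟨h1 ▸ hx'.1, h2 ▸ M.parent_mem w x hx'.1 hx'.2⟩
    · exact ⟨h2 ▸ M.parent_mem w x hx'.1 hx'.2, h1 ▸ hx'.1⟩
  -- Two vertices with the same parent edge would be each other's parents, contradicting the
  -- decrease of rank.
  have hone : ((M.inner w).filter fun x => s(x, M.parent w x) = s(u, v)).card ≤ 1 := by
    refine Finset.card_le_one.2 fun x hx y hy => ?_
    rw [Finset.mem_filter] at hx hy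
    by_contra hne
    rcases Sym2.eq_iff.1 (hx.2.trans hy.2.symm) with ⟨h1, _⟩ | ⟨h1, h2⟩
    · exact hne h1
    · have hx' := M.mem_inner.1 hx.1
      have hy' := M.mem_inner.1 hy.1
      have hlt := M.rank_parent_lt w x hx'.1 hx'.2
      have hlt' := M.rank_parent_lt w y hy'.1 hy'.2
      rw [h2] at hlt
      rw [← h1] at hlt'
      omega
  have hone' : (((M.inner w).filter fun x => s(x, M.parent w x) = s(u, v)).card : ℝ) ≤ 1 := by
    exact_mod_cast hone
  have hempty : ¬ (u ∈ M.part w ∧ v ∈ M.part w) →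
      ((M.inner w).filter fun x => s(x, M.parent w x) = s(u, v)) = ∅ := fun h =>
    Finset.filter_eq_empty_iff.2 fun x hx he => h (hpart x hx he)
  by_cases hu : u ∈ M.part w <;> by_cases hv : v ∈ M.part w
  · simp only [hu, hv, if_true]
    linarith
  · rw [hempty (by simp [hv])]
    simpa [hu, hv] using h2
  · rw [hempty (by simp [hu])]
    simpa [hu, hv] using h2
  · have : (Finset.univ.filter fun j => M.edge w j = s(u, v)) = ∅ := by
      refine Finset.filter_eq_empty_iff.2 fun j _ he => ?_
      obtain ⟨x, hx, hxw⟩ := M.edge_touch w j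
      rw [he, Sym2.mem_iff] at hx
      rcases hx with rfl | rfl
      · exact hu hxw
      · exact hv hxw
    rw [hempty (by simp [hu]), this]
    simp [hu, hv]

open Classical in
theorem sum_card_fiber [Fintype V] {X : Type*} (s : Finset X) (g : X → Sym2 V)
    (F : G.Subgraph) :
    ∑ e with e ∈ F.edgeSet, ((s.filter fun x => g x = e).card : ℝ) =
      (s.filter fun x => g x ∈ F.edgeSet).card := by
  rw [Finset.card_eq_sum_card_fiberwise (f := g) (t := Finset.univ.filter (· ∈ F.edgeSet))
    (fun x hx => by simpa using (Finset.mem_filter.1 hx).2)]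
  push_cast
  refine Finset.sum_congr rfl fun e he => ?_
  rw [Finset.filter_filter]
  congr 2
  refine Finset.filter_congr fun x _ => ?_
  have := (Finset.mem_filter.1 he).2
  constructor
  · rintro rfl
    exact ⟨this, rfl⟩
  · exact fun h => h.2

open Classical in
theorem sum_edgeWeight [Fintype V] [Fintype J] (M : ProjectedMinor G W J q) (w : W)
    (F : G.Subgraph) :
    ∑ e with e ∈ F.edgeSet, M.edgeWeight w e =
      ((M.inner w).filter fun v => s(v, M.parent w v) ∈ F.edgeSet).card +
    ((Finset.univ.filter fun j => M.edge w j ∈ F.edgeSet).card : ℝ) / Fintype.card J := by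
  unfold edgeWeight
  rw [Finset.sum_add_distrib, ← Finset.sum_div, sum_card_fiber, sum_card_fiber]

end ProjectedMinor

/-! ### The threshold weighting and its lower bound -/

namespace ProjectedMinor

variable {V W J : Type*} {G : SimpleGraph V} {q : ℕ}

open Classical in
theorem weightDiff_eq [Fintype V] [Fintype W] [Fintype J] (M : ProjectedMinor G W J q)
    (F : G.Subgraph) :
    weightDiff (fun v => (Nat.card {w // v ∈ M.part w} : ℝ) / q)
      (fun e => if e ∈ G.edgeSet then (∑ w, M.edgeWeight w e) / q else 0) F =
      (∑ w, M.contribution w F) / q := by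
  unfold weightDiff
  have h1 : ∑ e with e ∈ F.edgeSet,
      (if e ∈ G.edgeSet then (∑ w, M.edgeWeight w e) / q else 0) =
      (∑ w, ∑ e with e ∈ F.edgeSet, M.edgeWeight w e) / q := by
    rw [Finset.sum_comm, Finset.sum_div]
    exact Finset.sum_congr rfl fun e he =>
      if_pos (F.edgeSet_subset (Finset.mem_filter.1 he).2)
  have h2 : ∑ v with v ∈ F.verts, (Nat.card {w // v ∈ M.part w} : ℝ) =
      ∑ w, ((Finset.univ.filter fun v => v ∈ F.verts ∧ v ∈ M.part w).card : ℝ) := by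
    have : ∀ v, (Nat.card {w // v ∈ M.part w} : ℝ) = ∑ w, if v ∈ M.part w then 1 else 0 := by
      intro v
      rw [Finset.sum_boole, Nat.card_eq_fintype_card, Fintype.card_subtype]
    simp_rw [this]
    rw [Finset.sum_comm]
    refine Finset.sum_congr rfl fun w _ => ?_
    rw [Finset.sum_boole, Finset.filter_filter]
  rw [h1, ← Finset.sum_div, h2, ← sub_div, ← Finset.sum_sub_distrib]
  congr 1
  refine Finset.sum_congr rfl fun w _ => ?_
  rw [sum_edgeWeight]
  unfold contribution
  ring

open Classical in
/-- The threshold weighting defined by a projected minor. -/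
noncomputable def weighting [Fintype V] [Fintype W] [Fintype J] [Nonempty J]
    (M : ProjectedMinor G W J q) : ThresholdWeighting G where
  α v := (Nat.card {w // v ∈ M.part w} : ℝ) / q
  β e := if e ∈ G.edgeSet then (∑ w, M.edgeWeight w e) / q else 0
  α_mem v := ⟨by positivity, div_le_one_of_le₀ (by exact_mod_cast M.load v) (by positivity)⟩
  β_mem e he := by
    rw [if_pos he]
    induction e with | _ u v
    refine ⟨div_nonneg (Finset.sum_nonneg fun w _ => ?_) (by positivity),
      div_le_of_le_mul₀ (by positivity) (by norm_num) ?_⟩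
    · unfold edgeWeight
      positivity
    · have hload : ∀ v, ∑ w, (if v ∈ M.part w then (1 : ℝ) else 0) ≤ q := by
        intro v
        rw [Finset.sum_boole, ← Fintype.card_subtype, ← Nat.card_eq_fintype_card]
        exact_mod_cast M.load v
      calc ∑ w, M.edgeWeight w s(u, v)
          ≤ ∑ w, ((if u ∈ M.part w then (1 : ℝ) else 0) + (if v ∈ M.part w then 1 else 0)) :=
            Finset.sum_le_sum fun w _ => M.edgeWeight_le w u v
        _ ≤ 2 * q := by
            rw [Finset.sum_add_distrib]
            linarith [hload u, hload v]
  β_eq_zero e he := if_neg he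
  nonneg F := by
    rw [weightDiff_eq]
    exact div_nonneg (Finset.sum_nonneg fun w _ => M.contribution_nonneg w F) (by positivity)
  eq_zero := by
    rw [weightDiff_eq]
    simp [contribution_top]

/-- An edge of `G` is assigned to few pairs. -/
theorem card_edge_eq_le [Finite W] [Finite J] (M : ProjectedMinor G W J q) (e : Sym2 V) :
    Nat.card {x : W × J // M.edge x.1 x.2 = e} ≤ 2 * q * Nat.card J := by
  classical
  have := Fintype.ofFinite W
  have := Fintype.ofFinite J
  induction e with | _ u v
  let A : V → Finset W := fun v => Finset.univ.filter fun w => v ∈ M.part w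
  have hA : ∀ v, (A v).card ≤ q := by
    intro v
    have := M.load v
    rwa [Nat.card_eq_fintype_card, Fintype.card_subtype] at this
  rw [Nat.card_eq_fintype_card, Fintype.card_subtype, Nat.card_eq_fintype_card]
  calc _ ≤ ((A u ∪ A v) ×ˢ (Finset.univ : Finset J)).card := by
        refine Finset.card_le_card fun x hx => ?_
        have hx' := (Finset.mem_filter.1 hx).2
        obtain ⟨y, hy, hyw⟩ := M.edge_touch x.1 x.2
        rw [hx', Sym2.mem_iff] at hy
        rcases hy with rfl | rfl <;> simp [A, hyw]
    _ = (A u ∪ A v).card * Fintype.card J := by rw [Finset.card_product, Finset.card_univ]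
    _ ≤ 2 * q * Fintype.card J := by
        refine Nat.mul_le_mul_right _ ((Finset.card_union_le _ _).trans ?_)
        linarith [hA u, hA v]

/-- If the edges of a projected minor follow expanding functions, then every union sequence has a
member of large weight. -/
theorem exists_weightDiff_ge [Fintype V] [Fintype W] [Fintype J] [Nonempty J] [Nonempty W]
    (M : ProjectedMinor G W J q) (f : J → W → W)
    (hf : ∀ w j, ∃ u ∈ M.edge w j, u ∈ M.part (f j w))
    (hexp : ∀ A B : Finset W, Fintype.card W ≤ 6 * A.card → Fintype.card W ≤ 6 * B.card →
      ∃ j, ∃ x ∈ A, f j x ∈ B)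
    (hq : 6 * q ≤ Fintype.card W) (S : UnionSequence G) :
    ∃ i, (Fintype.card W : ℝ) / (6 * Fintype.card J * q) ≤
      weightDiff M.weighting.α M.weighting.β (S.graph i) := by
  classical
  have hJ : 0 < Fintype.card J := Fintype.card_pos
  have hW : 0 < Fintype.card W := Fintype.card_pos
  -- A single edge is chosen by at most `2 * q * |J|` pairs, at most a third of all since `6 * q ≤
  -- |W|`.
  obtain ⟨i, hlow, hhigh⟩ := S.exists_balanced (fun x : W × J => M.edge x.1 x.2)
    (fun x => M.edge_mem x.1 x.2) Nat.card_pos (fun e _ => by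
      have := M.card_edge_eq_le e
      rw [Nat.card_prod, Nat.card_eq_fintype_card (α := W)]
      nlinarith)
  refine ⟨i, ?_⟩
  set F := S.graph i
  rw [Nat.card_prod, Nat.card_eq_fintype_card (α := W), Nat.card_eq_fintype_card (α := J),
    Nat.card_eq_fintype_card, Fintype.card_subtype] at hlow hhigh
  set D := Finset.univ.filter fun x : W × J => M.edge x.1 x.2 ∈ F.edgeSet with hD
  -- `A` is fully inside `F`, `B` avoids `F`, and `X` is mixed.
  let A : Finset W := Finset.univ.filter fun w => ∀ j, M.edge w j ∈ F.edgeSet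
  let B : Finset W := Finset.univ.filter fun w => ∀ u ∈ F.verts, u ∉ M.part w
  let X : Finset W := Finset.univ.filter fun w =>
    (∃ u ∈ F.verts, u ∈ M.part w) ∧ ∃ j, M.edge w j ∉ F.edgeSet
  have hDsub : D ⊆ (A ∪ X) ×ˢ Finset.univ := by
    rintro ⟨w, j⟩ hx
    have hx' : M.edge w j ∈ F.edgeSet := (Finset.mem_filter.1 hx).2
    obtain ⟨u, hu, huw⟩ := M.edge_touch w j
    have huF := F.mem_verts_of_mem_edge hx' hu
    by_cases hA : ∀ j, M.edge w j ∈ F.edgeSet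
    · simp [A, hA]
    · push Not at hA
      simpa [X, A, hA] using Or.inr ⟨u, huF, huw⟩
  have hDcsub : Dᶜ ⊆ (B ∪ X) ×ˢ Finset.univ := by
    rintro ⟨w, j⟩ hx
    have hx' : M.edge w j ∉ F.edgeSet := by simpa [hD] using hx
    by_cases hB : ∃ u ∈ F.verts, u ∈ M.part w
    · have : w ∈ X := by
        simp only [X, Finset.mem_filter, Finset.mem_univ, true_and]
        exact ⟨hB, j, hx'⟩
      simp [this]
    · have : w ∈ B := by
        push Not at hB
        simpa [B] using hB
      simp [this]
  have h1 : D.card ≤ (A.card + X.card) * Fintype.card J := by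
    refine (Finset.card_le_card hDsub).trans ?_
    rw [Finset.card_product, Finset.card_univ]
    exact Nat.mul_le_mul_right _ (Finset.card_union_le _ _)
  have h2 : (Dᶜ).card ≤ (B.card + X.card) * Fintype.card J := by
    refine (Finset.card_le_card hDcsub).trans ?_
    rw [Finset.card_product, Finset.card_univ]
    exact Nat.mul_le_mul_right _ (Finset.card_union_le _ _)
  have h3 : (Dᶜ).card + D.card = Fintype.card W * Fintype.card J := by
    rw [Finset.card_compl_add_card, Fintype.card_prod]
  have hAX : Fintype.card W ≤ 3 * (A.card + X.card) :=
    Nat.le_of_mul_le_mul_right (by linarith) hJ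
  have hBX : Fintype.card W ≤ 3 * (B.card + X.card) :=
    Nat.le_of_mul_le_mul_right (by linarith) hJ
  -- Otherwise `A` and `B` are both large, and expansion gives an edge of `F` touching a part that
  -- avoids `F`.
  have hX : Fintype.card W ≤ 6 * X.card := by
    by_contra! hX
    obtain ⟨j, w, hwA, hwB⟩ := hexp A B (by omega) (by omega)
    obtain ⟨u, hu, huw⟩ := hf w j
    exact (Finset.mem_filter.1 hwB).2 u
      (F.mem_verts_of_mem_edge ((Finset.mem_filter.1 hwA).2 j) hu) huw
  have hX' : (Fintype.card W : ℝ) ≤ 6 * X.card := by exact_mod_cast hX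
  have hJ' : (0 : ℝ) < Fintype.card J := by exact_mod_cast hJ
  calc (Fintype.card W : ℝ) / (6 * Fintype.card J * q)
      = (Fintype.card W / 6 * (1 / Fintype.card J)) / q := by field_simp
    _ ≤ (X.card * (1 / Fintype.card J : ℝ)) / q := by gcongr; linarith
    _ ≤ (∑ w ∈ X, M.contribution w F) / q := by
        gcongr
        rw [← nsmul_eq_mul]
        refine Finset.card_nsmul_le_sum _ _ _ fun w hw => ?_
        obtain ⟨⟨u, hu, huw⟩, j, hj⟩ := (Finset.mem_filter.1 hw).2
        exact M.le_contribution hu huw hj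
    _ ≤ (∑ w, M.contribution w F) / q := by
        gcongr
        · exact fun w _ _ => M.contribution_nonneg w F
        · exact Finset.subset_univ X
    _ = weightDiff M.weighting.α M.weighting.β F := (M.weightDiff_eq F).symm

end ProjectedMinor

/-! ### From admissibility to a lower bound on `kappa` -/

theorem NoIsolated.exists_adj {V : Type*} {G : SimpleGraph V} (hG : NoIsolated G) (v : V) :
    ∃ u, G.Adj v u := by
  by_contra! h
  exact hG v h

/-- A minor mapping into a blowup projects to the base graph. -/
theorem IsGraphMinor.exists_projectedMinor {V W J : Type*} {G : SimpleGraph V}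
    (hG : NoIsolated G) {H : SimpleGraph W} {q : ℕ} (hH : IsGraphMinor H (cliqueBlowup G q))
    (f : J → W → W) (hf : ∀ j w, f j w = w ∨ H.Adj w (f j w)) :
    ∃ M : ProjectedMinor G W J q, ∀ w j, ∃ u ∈ M.edge w j, u ∈ M.part (f j w) := by
  obtain ⟨φ, hconn, hdisj, hadj⟩ := hH
  have hpar := fun w => (hconn w).coe.exists_parent G (fun x => x.1.1) fun x y h =>
    ((φ w).adj_sub h).2
  choose root parent rank hroot hparent using hpar
  let part : W → Set V := fun w => Set.range fun x : (φ w).verts => x.1.1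
  have hedge : ∀ w j, ∃ e ∈ G.edgeSet, (∃ u ∈ e, u ∈ part w) ∧ ∃ u ∈ e, u ∈ part (f j w) := by
    intro w j
    rcases hf j w with h | h
    · obtain ⟨z, hz⟩ := hG.exists_adj (root w)
      rw [h]
      exact ⟨s(root w, z), hz, ⟨_, Sym2.mem_mk_left _ _, hroot w⟩,
        ⟨_, Sym2.mem_mk_left _ _, hroot w⟩⟩
    · obtain ⟨x, hx, y, hy, hxy⟩ := hadj _ _ h
      -- If the joining edge lies within one clique, the two projections share a vertex, and any
      -- edge of `G` there serves.
      rcases hxy.2 with h1 | h1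
      · obtain ⟨z, hz⟩ := hG.exists_adj x.1
        exact ⟨s(x.1, z), hz, ⟨_, Sym2.mem_mk_left _ _, ⟨⟨x, hx⟩, rfl⟩⟩,
          ⟨_, Sym2.mem_mk_left _ _, ⟨⟨y, hy⟩, h1.symm⟩⟩⟩
      · exact ⟨s(x.1, y.1), h1, ⟨_, Sym2.mem_mk_left _ _, ⟨⟨x, hx⟩, rfl⟩⟩,
          ⟨_, Sym2.mem_mk_right _ _, ⟨⟨y, hy⟩, rfl⟩⟩⟩
  choose edge hedge_mem htouch htouch' using hedge
  refine ⟨⟨part, root, parent, rank, edge, hroot, fun w v hv h => (hparent w v hv h).1,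
    fun w v hv h => (hparent w v hv h).2.1, fun w v hv h => (hparent w v hv h).2.2,
    hedge_mem, htouch, fun v => ?_⟩, htouch'⟩
  have : ∀ w : {w // v ∈ part w}, ∃ i, (v, i) ∈ (φ w).verts := by
    rintro ⟨w, ⟨⟨u, i⟩, hx⟩, rfl⟩
    exact ⟨i, hx⟩
  choose c hc using this
  have hinj : Function.Injective c := by
    intro w w' h
    by_contra hne
    have h1 := hc w'
    rw [← h] at h1
    exact Set.disjoint_left.1 (hdisj w w' fun h => hne (Subtype.ext h)) (hc w) h1
  simpa using Nat.card_le_card_of_injective c hinj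

/-- There are large graphs of bounded average degree that follow expanding functions. -/
theorem exists_expanding_graph (n : ℕ) (hn : 2 ≤ n) :
    ∃ (f : Option (Fin 48) → Fin n → Fin n) (H : SimpleGraph (Fin n)),
      NoIsolated H ∧ (∀ j w, f j w = w ∨ H.Adj w (f j w)) ∧
      n ≤ 2 * H.edgeSet.ncard ∧ H.edgeSet.ncard ≤ 49 * n ∧
      ∀ A B : Finset (Fin n), n ≤ 6 * A.card → n ≤ 6 * B.card →
        ∃ j, ∃ x ∈ A, f j x ∈ B := by
  obtain ⟨k, rfl⟩ := Nat.exists_eq_add_of_le' hn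
  classical
  obtain ⟨g, hg⟩ := exists_expanding_functions (k + 2) (by omega)
  -- The extra shift `x + 1` rules out isolated vertices.
  let f : Option (Fin 48) → Fin (k + 2) → Fin (k + 2) := fun j => j.elim (fun x => x + 1) g
  let H : SimpleGraph (Fin (k + 2)) := SimpleGraph.fromRel fun x y => ∃ j, f j x = y
  have hH : NoIsolated H := fun v hv =>
    hv (w := v + 1) ((SimpleGraph.fromRel_adj _ _ _).2 ⟨by simp, Or.inl ⟨none, rfl⟩⟩)
  refine ⟨f, H, hH, fun j w => ?_, ?_, ?_, fun A B hA hB => ?_⟩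
  · by_cases h : f j w = w
    · exact Or.inl h
    · exact Or.inr ((SimpleGraph.fromRel_adj _ _ _).2 ⟨Ne.symm h, Or.inl ⟨j, rfl⟩⟩)
  · have h1 := H.sum_degrees_eq_twice_card_edges
    have h2 : H.edgeSet.ncard = H.edgeFinset.card := Set.ncard_eq_toFinset_card' _
    rw [h2, ← h1]
    calc k + 2 = ∑ _v : Fin (k + 2), 1 := by simp
      _ ≤ ∑ v, H.degree v := Finset.sum_le_sum fun v _ => by
          rw [Nat.succ_le_iff, SimpleGraph.degree_pos_iff_exists_adj]
          exact hH.exists_adj v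
  · have hsub : H.edgeSet ⊆ Set.range fun p : Fin (k + 2) × Option (Fin 48) =>
        s(p.1, f p.2 p.1) := by
      intro e
      induction e with | _ x y
      intro h
      rcases ((SimpleGraph.fromRel_adj _ _ _).1 ((SimpleGraph.mem_edgeSet H).1 h)).2 with ⟨j, hj⟩ | ⟨j, hj⟩
      · exact ⟨(x, j), by simp [hj]⟩
      · exact ⟨(y, j), by simp [hj, Sym2.eq_swap]⟩
    refine (Set.ncard_le_ncard hsub (Set.toFinite _)).trans ?_
    rw [← Set.image_univ]
    refine (Set.ncard_image_le Set.finite_univ).trans ?_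
    simp [Set.ncard_univ, mul_comm]
  · obtain ⟨j, x, hx, h⟩ := hg A B hA hB
    exact ⟨some j, x, hx, h⟩

/-- The constant is `14700 = 6 * 49 * 50`: expansion loss, number of functions, and `q * r ≤ 50 *
n`. -/
theorem EmbAdmissible.le_kappa {V : Type*} [Fintype V] {G : SimpleGraph V}
    (hG : NoIsolated G) {r : ℝ} (hr : 600 ≤ r) (h : EmbAdmissible G r) :
    ENNReal.ofReal (r / 14700) ≤ kappa G := by
  obtain ⟨m₀, hm₀⟩ := h
  have hr0 : 0 < r := by linarith
  -- The terms give `m ≥ m₀`, room for rounding in `6 * q ≤ n`, and `r ≤ n` to absorb the ceiling in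
  -- `q * r`.
  obtain ⟨n, hn⟩ : ∃ n, n = 2 * m₀ + 12 + ⌈r⌉₊ := ⟨_, rfl⟩
  obtain ⟨f, H, hH, hfH, hlow, hhigh, hexp⟩ := exists_expanding_graph n (by omega)
  have hk : r ≤ n := (Nat.le_ceil r).trans (by
    exact_mod_cast (show ⌈r⌉₊ ≤ n by omega))
  have hk' : (12 : ℝ) ≤ n := by exact_mod_cast (show 12 ≤ n by omega)
  have hminor := hm₀ _ H hH (by omega)
  set m := H.edgeSet.ncard
  obtain ⟨q, hq⟩ : ∃ q, q = ⌈(m : ℝ) / r⌉₊ := ⟨_, rfl⟩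
  rw [← hq] at hminor
  have hhigh' : (m : ℝ) ≤ 49 * n := by exact_mod_cast hhigh
  have hq1 : (q : ℝ) < 49 * n / r + 1 := by
    rw [hq]
    refine (Nat.ceil_lt_add_one (by positivity)).trans_le ?_
    gcongr
  have hq2 : 6 * q ≤ n := by
    have : 49 * (n : ℝ) / r ≤ n / 12 := by
      rw [div_le_div_iff₀ hr0 (by norm_num)]
      nlinarith
    have : (6 : ℝ) * q ≤ n := by linarith
    exact_mod_cast this
  have hq3 : (q : ℝ) * r ≤ 50 * n := by
    have : (q : ℝ) * r ≤ (49 * n / r + 1) * r := by gcongr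
    rw [add_mul, div_mul_cancel₀ _ hr0.ne'] at this
    linarith
  have hq0 : (0 : ℝ) < q := by
    have : 0 < m := by omega
    rw [hq]
    exact_mod_cast Nat.ceil_pos.2 (by positivity)
  have : Nonempty (Fin n) := ⟨⟨0, by omega⟩⟩
  obtain ⟨M, hM⟩ := hminor.exists_projectedMinor hG f hfH
  refine le_trans ?_ (le_iSup _ M.weighting)
  refine le_iInf fun S => ?_
  obtain ⟨i, hi⟩ := M.exists_weightDiff_ge f hM (by simpa using hexp) (by simpa using hq2) S
  refine le_trans (ENNReal.ofReal_le_ofReal (le_trans ?_ hi))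
    (le_iSup (fun i => ENNReal.ofReal (weightDiff _ _ (S.graph i))) i)
  simp only [Fintype.card_fin, Fintype.card_option]
  rw [div_le_div_iff₀ (by norm_num) (by positivity)]
  push_cast
  nlinarith

/-! ### A constant lower bound on `kappa` from a two-edge path -/

open Classical in
theorem weightDiff_cherry {V : Type*} [Fintype V] {G : SimpleGraph V} {v a b : V}
    (hab : a ≠ b) (F : G.Subgraph) :
    weightDiff (fun x => if x = v then 1 else 0)
      (fun e => if e = s(v, a) then 1 / 2 else if e = s(v, b) then 1 / 2 else 0) F =
      (if v ∈ F.verts then 1 else 0) - (if s(v, a) ∈ F.edgeSet then 1 / 2 else 0) -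
        (if s(v, b) ∈ F.edgeSet then 1 / 2 else 0) := by
  have hne : s(v, b) ≠ s(v, a) := fun h => hab (Sym2.congr_right.1 h).symm
  have h : ∀ e, (if e = s(v, a) then (1 : ℝ) / 2 else if e = s(v, b) then 1 / 2 else 0) =
      (if e = s(v, a) then 1 / 2 else 0) + if e = s(v, b) then 1 / 2 else 0 := by
    intro e
    by_cases h1 : e = s(v, a)
    · subst h1
      simp [hne.symm]
    · simp [h1]
  unfold weightDiff
  simp_rw [h]
  rw [Finset.sum_add_distrib, Finset.sum_ite_eq', Finset.sum_ite_eq', Finset.sum_ite_eq']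
  simp only [Finset.mem_filter, Finset.mem_univ, true_and]
  ring

open Classical in
/-- The threshold weighting supported on a path with two edges. -/
noncomputable def cherryWeighting {V : Type*} [Fintype V] {G : SimpleGraph V} {v a b : V}
    (hab : a ≠ b) (ha : G.Adj v a) (hb : G.Adj v b) : ThresholdWeighting G where
  α x := if x = v then 1 else 0
  β e := if e = s(v, a) then 1 / 2 else if e = s(v, b) then 1 / 2 else 0
  α_mem x := by split_ifs <;> simp
  β_mem e _ := by split_ifs <;> norm_num
  β_eq_zero e he := by
    rw [if_neg, if_neg]
    · rintro rfl
      exact he hb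
    · rintro rfl
      exact he ha
  nonneg F := by
    rw [weightDiff_cherry hab]
    by_cases hv : v ∈ F.verts
    · rw [if_pos hv]
      split_ifs <;> norm_num
    · rw [if_neg hv, if_neg fun h : s(v, a) ∈ F.edgeSet => hv (F.edge_vert h),
        if_neg fun h : s(v, b) ∈ F.edgeSet => hv (F.edge_vert h)]
      norm_num
  eq_zero := by
    rw [weightDiff_cherry hab]
    simp only [SimpleGraph.Subgraph.verts_top, Set.mem_univ, SimpleGraph.Subgraph.edgeSet_top,
      SimpleGraph.mem_edgeSet, ha, hb, if_true]
    norm_num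

/-- Every edge of `G` occurs in every union sequence of `G`. -/
theorem UnionSequence.exists_graph_eq_subgraphOfAdj {V : Type*} {G : SimpleGraph V}
    (S : UnionSequence G) {u v : V} (h : G.Adj u v) : ∃ i, S.graph i = G.subgraphOfAdj h := by
  -- Unions create no new edges, so an edge traces back to a member that is that edge alone.
  have key : ∀ i, s(u, v) ∈ (S.graph i).edgeSet → ∃ i, S.graph i = G.subgraphOfAdj h := by
    intro i
    induction i using WellFoundedLT.induction with
    | ind i ih =>
      intro hi
      rcases S.edge_or_union i with ⟨x, y, hxy, he⟩ | ⟨j, k, hj, hk, he⟩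
      · refine ⟨i, ?_⟩
        rw [he, SimpleGraph.edgeSet_subgraphOfAdj, Set.mem_singleton_iff] at hi
        rw [he]
        rcases Sym2.eq_iff.1 hi with ⟨rfl, rfl⟩ | ⟨rfl, rfl⟩
        · rfl
        · exact SimpleGraph.subgraphOfAdj_symm hxy.symm
      · rw [he, SimpleGraph.Subgraph.edgeSet_sup] at hi
        exact hi.elim (ih j hj) (ih k hk)
  refine key (Fin.last _) ?_
  rw [S.graph_last]
  simpa using h

/-- The unavoidable member `va` keeps the weight 1 of `v` and loses only `1 / 2`. -/
theorem half_le_kappa {V : Type*} [Fintype V] {G : SimpleGraph V} {v a b : V}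
    (hab : a ≠ b) (ha : G.Adj v a) (hb : G.Adj v b) : ENNReal.ofReal (1 / 2) ≤ kappa G := by
  classical
  refine le_trans ?_ (le_iSup _ (cherryWeighting hab ha hb))
  refine le_iInf fun S => ?_
  obtain ⟨i, hi⟩ := S.exists_graph_eq_subgraphOfAdj ha
  refine le_trans (ENNReal.ofReal_le_ofReal ?_)
    (le_iSup (fun i => ENNReal.ofReal (weightDiff _ _ (S.graph i))) i)
  have hne : s(v, b) ≠ s(v, a) := fun h => hab (Sym2.congr_right.1 h).symm
  have h := weightDiff_cherry (v := v) hab (S.graph i)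
  have h' : weightDiff (cherryWeighting hab ha hb).α (cherryWeighting hab ha hb).β (S.graph i) =
      1 - 1 / 2 - 0 := by
    refine h.trans ?_
    rw [hi]
    simp only [SimpleGraph.edgeSet_subgraphOfAdj, Set.mem_singleton_iff, hne, if_true, if_false]
    simp
  rw [h']
  norm_num

/-- Values `r` below 600 are absorbed by the 1 in the maximum. -/
theorem emb_le_mul_max_kappa {V : Type*} [Fintype V] {G : SimpleGraph V} (hG : NoIsolated G) :
    emb G ≤ (14700 : ℝ≥0) * max (kappa G) 1 := by
  refine iSup₂_le fun r hr => ?_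
  have hmul : ENNReal.ofReal r = (14700 : ℝ≥0) * ENNReal.ofReal (r / 14700) := by
    rw [show ((14700 : ℝ≥0) : ℝ≥0∞) = ENNReal.ofReal 14700 by simp,
      ← ENNReal.ofReal_mul (by norm_num)]
    congr 1
    ring
  rw [hmul]
  gcongr
  rcases le_total 600 r with h | h
  · exact (hr.2.le_kappa hG h).trans (le_max_left _ _)
  · refine le_trans ?_ (le_max_right _ _)
    rw [ENNReal.ofReal_le_one, div_le_one (by norm_num)]
    linarith

theorem mainTheorem2 :
    ∃ C : ℝ≥0, ∀ (V : Type*) [Fintype V] (G : SimpleGraph V), NoIsolated G →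
      emb G ≤ C * max (kappa G) 1 ∧
      ((∃ v a b, a ≠ b ∧ G.Adj v a ∧ G.Adj v b) → emb G ≤ C * kappa G) := by
  refine ⟨14700 * 2, fun V _ G hG => ⟨(emb_le_mul_max_kappa hG).trans ?_, ?_⟩⟩
  · gcongr
    norm_num
  · rintro ⟨v, a, b, hab, ha, hb⟩
    refine (emb_le_mul_max_kappa hG).trans ?_
    rw [ENNReal.coe_mul, mul_assoc]
    gcongr
    have h := half_le_kappa hab ha hb
    have h1 : (1 : ℝ≥0∞) ≤ (2 : ℝ≥0) * kappa G := by
      calc (1 : ℝ≥0∞) = (2 : ℝ≥0) * ENNReal.ofReal (1 / 2) := by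
            rw [show ((2 : ℝ≥0) : ℝ≥0∞) = ENNReal.ofReal 2 by simp,
              ← ENNReal.ofReal_mul (by norm_num)]
            norm_num
        _ ≤ _ := by gcongr
    refine max_le ?_ h1
    calc kappa G = 1 * kappa G := (one_mul _).symm
      _ ≤ _ := by
        gcongr
        norm_num
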